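/- Let $n\ge 1$ and $k\ge 1$ be integers. An $n$-ary quasigroup of order $k$ on $\Sigma=\{0,1,\ldots,k-1\}$ is a map $f:\Sigma^n\to\Sigma$ such that in the equality $z_0=f(z_1,\ldots,z_n)$ any $n$ of the elements $z_0,z_1,\ldots,z_n$ uniquely specify the remaining one. Let $Q(n,k)$ be the set of all such maps. Then $$|Q(n,k)|\ \ge\ 2^{\lfloor k/2\rfloor\lfloor k/3\rfloor^{n-1}}$$ (with the convention $0^0=1$). Moreover, for every $k\ge 3$, $$2^{\lfloor k/2\rfloor\lfloor k/3\rfloor^{n-1}}\ >\ e^{e^{\,n\ln\lfloor k/3\rfloor+\ln\lfloor k/2\rfloor-\ln\lfloor k/3\rfloor-0.367}} \qquad\text{and}\qquad |Q(n,k)|\ >\ e^{e^{\,n\ln\lfloor k/3\rfloor+0.038}},$$ and, if in addition $k\not\equiv 3 \pmod 6$ or $k\ge 2151$, $$e^{e^{\,n\ln\lfloor k/3\rfloor+\ln\lfloor k/2\rfloor-\ln\lfloor k/3\rfloor-0.367}}\ >\ e^{e^{\,n\ln\lfloor k/3\rfloor+0.038}}.$$ -/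

import Mathlib

/-- An operation `f : α^n → α` is an `n`-ary quasigroup if in the equality
`z₀ = f (z₁, …, zₙ)` any `n` of the `n + 1` elements `z₀, z₁, …, zₙ` uniquely specify
the remaining one. (That `z₁, …, zₙ` specify `z₀` holds because `f` is a function.) -/
def IsNQuasigroup {α : Type*} {n : ℕ} (f : (Fin n → α) → α) : Prop :=
  ∀ (i : Fin n) (z : Fin n → α) (z₀ : α), ∃! t : α, f (Function.update z i t) = z₀

/-- The set `Q(n, k)` of all `n`-ary quasigroups `{0, …, k-1}^n → {0, …, k-1}`. -/
def nQuasigroups (n k : ℕ) : Set ((Fin n → Fin k) → Fin k) :=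
  {f | IsNQuasigroup f}

/-! ### Quasigroups from group extensions -/

section Quasigroups

open Function

variable {X : Type*} {n : ℕ}

/-! For even `k` shift the fibres of a sum over `ZMod (k/2)` independently in `ZMod 2`. For odd `k =
2m+1 ≥ 7` iterate a Latin square with many order-two subsquares: each of the `m` row pairs meets
`m-1` column pairs in one. This leaves `m(m-1)^(n-1)` disjoint `2 × ⋯ × 2` blocks carrying a
two-valued parity function, and exchanging the two values in any set of blocks
(`IsNQuasigroup.switchBlocks`) gives distinct quasigroups; `m-1 ≥ ⌊k/3⌋`. The real inequalities are
numerical, except that small `k ≡ 3 (mod 6)` need the extension of `ZMod (k/3)` by `ZMod 3`. -/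

theorem IsNQuasigroup.injective {f : (Fin n → X) → X} (hf : IsNQuasigroup f) (i : Fin n)
    (z : Fin n → X) : Injective fun t => f (update z i t) := fun _ t h =>
  (hf i z (f (update z i t))).unique h rfl

theorem isNQuasigroup_of_injective [Finite X] {f : (Fin n → X) → X}
    (hf : ∀ i z, Injective fun t => f (update z i t)) : IsNQuasigroup f := by
  intro i z z₀
  obtain ⟨t, ht⟩ := Finite.surjective_of_injective (hf i z) z₀
  exact ⟨t, ht, fun s hs => hf i z (hs.trans ht.symm)⟩

/-- An injective family of quasigroups on a set of size `k` bounds `|Q(n, k)|` from below. -/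
theorem card_le_ncard_nQuasigroups {k : ℕ} [Fintype X] (hX : Fintype.card X = k) {C : Type*}
    [Fintype C] (F : C → (Fin n → X) → X) (hF : Injective F) (hq : ∀ c, IsNQuasigroup (F c)) :
    Fintype.card C ≤ (nQuasigroups n k).ncard := by
  let φ : X ≃ Fin k := Fintype.equivFinOfCardEq hX
  let G : C → (Fin n → Fin k) → Fin k := fun c x => φ (F c (φ.symm ∘ x))
  have hG : Injective G := by
    intro c d h
    apply hF
    funext x
    have := congrFun h (φ ∘ x)
    simpa [G, ← Function.comp_assoc] using this
  have hsub : Set.range G ⊆ nQuasigroups n k := by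
    rintro _ ⟨c, rfl⟩
    refine isNQuasigroup_of_injective fun i z s t h => ?_
    have h' : F c (φ.symm ∘ update z i s) = F c (φ.symm ∘ update z i t) := φ.injective h
    rw [comp_update, comp_update] at h'
    exact φ.symm.injective ((hq c).injective i _ h')
  calc Fintype.card C = (Set.range G).ncard := by
        rw [← Nat.card_coe_set_eq, Nat.card_range_of_injective hG, Nat.card_eq_fintype_card]
    _ ≤ _ := Set.ncard_le_ncard hsub (Set.toFinite _)

theorem sum_update_apply {M : Type*} [AddCommMonoid M] (φ : X → M) (z : Fin n → X) (i : Fin n)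
    (s : X) : ∑ j, φ (update z i s j) = φ s + ∑ j ∈ {i}ᶜ, φ (z j) := by
  rw [Fintype.sum_eq_add_sum_compl i, update_self]
  congr 1
  refine Finset.sum_congr rfl fun j hj => ?_
  rw [update_of_ne (by simpa using hj)]

/-- The shift `c` depends only on first components, whose sum determines them along a line, so any
`c` works. Used with `r = 2`, `r = 3`, and `t = 1`. -/
theorem pow_pow_le_ncard_nQuasigroups (n t r : ℕ) [NeZero t] [NeZero r] :
    r ^ t ^ n ≤ (nQuasigroups n (t * r)).ncard := by
  let F : ((Fin n → ZMod t) → ZMod r) → (Fin n → ZMod t × ZMod r) → ZMod t × ZMod r :=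
    fun c x => (∑ j, (x j).1, ∑ j, (x j).2 + c fun j => (x j).1)
  have key := card_le_ncard_nQuasigroups (k := t * r) (by simp [ZMod.card]) F ?_ ?_
  · simpa [ZMod.card] using key
  · intro c d h
    funext a
    simpa [F] using congrArg Prod.snd (congrFun h fun j => (a j, 0))
  · refine fun c => isNQuasigroup_of_injective fun i z s s' h => ?_
    have h₁ := congrArg Prod.fst h
    have h₂ := congrArg Prod.snd h
    simp only [F, sum_update_apply Prod.fst, add_left_inj] at h₁
    have h₃ : (fun j => (update z i s j).1) = fun j => (update z i s' j).1 := by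
      funext j
      by_cases hj : j = i
      · subst hj; simpa using h₁
      · simp [hj]
    simp only [F, h₃, sum_update_apply Prod.snd, add_left_inj] at h₂
    exact Prod.ext h₁ h₂

end Quasigroups

/-! ### Switching disjoint blocks -/

section Switching

open Function

variable {X A : Type*} {n : ℕ}

/-- The point of the block with index `a` that has coordinates `e`. -/
def blockPoint (ι : A × ZMod 2 → X) (a : Fin n → A) (e : Fin n → ZMod 2) : Fin n → X :=
  fun s => ι (a s, e s)

theorem blockPoint_inj {ι : A × ZMod 2 → X} (hι : Injective ι) {a a' : Fin n → A}
    {e e' : Fin n → ZMod 2} (h : blockPoint ι a e = blockPoint ι a' e') : a = a' ∧ e = e' := by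
  have h' := fun s => hι (congrFun h s)
  exact ⟨funext fun s => congrArg Prod.fst (h' s), funext fun s => congrArg Prod.snd (h' s)⟩

open Classical in
/-- The operation `f` with its values flipped on all blocks from `S`. -/
noncomputable def switchBlocks (ι : A × ZMod 2 → X) (flip : X → X) (f : (Fin n → X) → X)
    (S : Set (Fin n → A)) (x : Fin n → X) : X :=
  if ∃ a ∈ S, ∃ e, x = blockPoint ι a e then flip (f x) else f x

/-- Within a block, moving one coordinate to its partner already flips the value; by injectivity on
the line this is the only place where the flipped value occurs. Hence flipping whole blocks creates
no collision with unflipped points. -/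
theorem exists_block_of_flip_eq {ι : A × ZMod 2 → X} {flip : X → X}
    (hflip : ∀ a e, flip (ι (a, e)) = ι (a, e + 1))
    {f : (Fin n → X) → X} (hf : IsNQuasigroup f) {w : (Fin n → A) → A} {S : Set (Fin n → A)}
    (hw : ∀ a ∈ S, ∀ e, f (blockPoint ι a e) = ι (w a, ∑ s, e s)) {i : Fin n} {z : Fin n → X}
    {s t : X} (hs : ∃ a ∈ S, ∃ e, update z i s = blockPoint ι a e)
    (h : flip (f (update z i s)) = f (update z i t)) :
    ∃ a ∈ S, ∃ e, update z i t = blockPoint ι a e := by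
  obtain ⟨a, ha, e, hae⟩ := hs
  refine ⟨a, ha, update e i (e i + 1), ?_⟩
  have hpt : blockPoint ι a (update e i (e i + 1)) = update z i (ι (a i, e i + 1)) := by
    funext j
    by_cases hj : j = i
    · subst hj; simp [blockPoint]
    · have := congrFun hae j
      simp only [update_of_ne hj] at this
      simp [blockPoint, hj, this]
  have hsum : ∑ j, update e i (e i + 1) j = ∑ j, e j + 1 := by
    have h₁ := sum_update_apply id e i (e i + 1)
    have h₂ := sum_update_apply id e i (e i)
    simp only [id, update_eq_self] at h₁ h₂
    rw [h₁, h₂]; ring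
  have h₃ : f (update z i t) = f (update z i (ι (a i, e i + 1))) := by
    rw [← h, hae, hw a ha, hflip, ← hpt, hw a ha, hsum]
  rw [hpt, hf.injective i z h₃]

theorem IsNQuasigroup.switchBlocks [Finite X] {ι : A × ZMod 2 → X} {flip : X → X}
    (hinj : Injective flip) (hflip : ∀ a e, flip (ι (a, e)) = ι (a, e + 1))
    {f : (Fin n → X) → X} (hf : IsNQuasigroup f) {w : (Fin n → A) → A} {S : Set (Fin n → A)}
    (hw : ∀ a ∈ S, ∀ e, f (blockPoint ι a e) = ι (w a, ∑ s, e s)) :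
    IsNQuasigroup (switchBlocks ι flip f S) := by
  refine isNQuasigroup_of_injective fun i z s t h => ?_
  simp only [_root_.switchBlocks] at h
  split_ifs at h with h₁ h₂ h₂
  · exact hf.injective i z (hinj h)
  · exact absurd (exists_block_of_flip_eq hflip hf hw h₁ h) h₂
  · exact absurd (exists_block_of_flip_eq hflip hf hw h₂ h.symm) h₁
  · exact hf.injective i z h

theorem two_pow_card_le_ncard_nQuasigroups {k : ℕ} [Fintype X] (hX : Fintype.card X = k)
    {ι : A × ZMod 2 → X} (hι : Injective ι) {flip : X → X}
    (hinj : Injective flip) (hflip : ∀ a e, flip (ι (a, e)) = ι (a, e + 1))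
    {f : (Fin n → X) → X} (hf : IsNQuasigroup f) {w : (Fin n → A) → A} {V : Finset (Fin n → A)}
    (hw : ∀ a ∈ V, ∀ e, f (blockPoint ι a e) = ι (w a, ∑ s, e s)) :
    2 ^ V.card ≤ (nQuasigroups n k).ncard := by
  classical
  have hne (a : A) (e : ZMod 2) : flip (ι (a, e)) ≠ ι (a, e) := by
    rw [hflip]
    intro h
    simpa using congrArg Prod.snd (hι h)
  have hblock (S : Set (Fin n → A)) (a : Fin n → A) (ha : a ∈ V) :
      switchBlocks ι flip f S (blockPoint ι a 0) ≠ f (blockPoint ι a 0) ↔ a ∈ S := by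
    constructor
    · intro h
      by_contra haS
      apply h
      rw [switchBlocks, if_neg]
      rintro ⟨b, hb, e, hbe⟩
      exact haS ((blockPoint_inj hι hbe).1 ▸ hb)
    · intro haS
      rw [switchBlocks, if_pos ⟨a, haS, 0, rfl⟩, hw a ha]
      exact hne _ _
  let F : V.powerset → (Fin n → X) → X := fun S => switchBlocks ι flip f (S.1 : Set (Fin n → A))
  have key := card_le_ncard_nQuasigroups hX F ?_ ?_
  · simpa using key
  · intro S T h
    have hS := Finset.mem_powerset.1 S.2
    have hT := Finset.mem_powerset.1 T.2
    ext a
    by_cases ha : a ∈ V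
    · have h₁ := hblock S.1 a ha
      have h₂ := hblock T.1 a ha
      have h₃ := congrFun h (blockPoint ι a 0)
      simp only [F] at h₃
      rw [h₃] at h₁
      simpa using h₁.symm.trans h₂
    · exact ⟨fun h => absurd (hS h) ha, fun h => absurd (hT h) ha⟩
  · refine fun S => hf.switchBlocks hinj hflip fun a ha => hw a ?_
    exact Finset.mem_powerset.1 S.2 (by simpa using ha)

/-- Iterating a binary quasigroup that has at least `t` blocks in every pair of rows. -/
theorem exists_iterated_quasigroup [Finite X] [Fintype A] {ι : A × ZMod 2 → X} {L : X → X → X}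
    (hl : ∀ x, Injective (L x)) (hr : ∀ y, Injective fun x => L x y) {q : A → A → A}
    {J : A → Finset A} {t : ℕ} (hJ : ∀ i, t ≤ (J i).card)
    (hL : ∀ i, ∀ j ∈ J i, ∀ e d, L (ι (i, e)) (ι (j, d)) = ι (q i j, e + d)) (n : ℕ) :
    ∃ (f : (Fin (n + 1) → X) → X) (w : (Fin (n + 1) → A) → A) (V : Finset (Fin (n + 1) → A)),
      IsNQuasigroup f ∧ Fintype.card A * t ^ n ≤ V.card ∧
        ∀ a ∈ V, ∀ e, f (blockPoint ι a e) = ι (w a, ∑ s, e s) := by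
  classical
  induction n with
  | zero =>
    refine ⟨fun x => x 0, fun a => a 0, Finset.univ, ?_, by simp, by simp [blockPoint]⟩
    intro i z z₀
    obtain rfl : i = 0 := Fin.fin_one_eq_zero i
    exact ⟨z₀, by simp, by simp⟩
  | succ n ih =>
    obtain ⟨f, w, V, hf, hV, hw⟩ := ih
    -- Extend a block by each column pair compatible with its value pair `w a`: there `L` adds
    -- parities, so the parity form persists.
    let V' : Finset (Fin (n + 2) → A) :=
      (V.sigma fun a => J (w a)).map
        ⟨fun p => Fin.cons p.2 p.1, by
          rintro ⟨a, j⟩ ⟨a', j'⟩ h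
          obtain ⟨rfl, rfl⟩ := Fin.cons_injective2 (α := fun _ => A) h
          rfl⟩
    refine ⟨fun x => L (f (Fin.tail x)) (x 0), fun a => q (w (Fin.tail a)) (a 0), V', ?_, ?_, ?_⟩
    · refine isNQuasigroup_of_injective fun i z s s' h => ?_
      induction i using Fin.cases with
      | zero => simpa using hl _ (by simpa using h)
      | succ i =>
        have h' : f (Fin.tail (update z i.succ s)) = f (Fin.tail (update z i.succ s')) :=
          hr (z 0) (by simpa [update_of_ne (Fin.succ_ne_zero i).symm] using h)
        rw [Fin.tail_update_succ, Fin.tail_update_succ] at h'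
        exact hf.injective i _ h'
    · rw [Finset.card_map, Finset.card_sigma]
      calc Fintype.card A * t ^ (n + 1) = Fintype.card A * t ^ n * t := by ring
        _ ≤ V.card * t := by gcongr
        _ ≤ _ := by simpa using Finset.card_nsmul_le_sum V (fun a => (J (w a)).card) t
                      fun a _ => hJ _
    · intro a ha e
      obtain ⟨⟨b, j⟩, hbj, rfl⟩ := Finset.mem_map.1 ha
      obtain ⟨hb, hj⟩ := Finset.mem_sigma.1 hbj
      have h₁ : Fin.tail (blockPoint ι (Fin.cons j b : Fin (n + 2) → A) e) =
          blockPoint ι b (Fin.tail e) := by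
        funext s; simp [blockPoint, Fin.tail]
      have h₂ : blockPoint ι (Fin.cons j b : Fin (n + 2) → A) e 0 = ι (j, e 0) := by
        simp [blockPoint]
      change L (f (Fin.tail (blockPoint ι (Fin.cons j b : Fin (n + 2) → A) e)))
        (blockPoint ι (Fin.cons j b : Fin (n + 2) → A) e 0) = ι (q (w b) j, _)
      rw [h₁, h₂, hw b hb, hL _ _ hj, Fin.sum_univ_succ e, add_comm (e 0)]
      rfl

end Switching

/-! ### Idempotent Latin squares of every order at least 3 -/

section IdempotentQuasigroups

open Function

/-- An idempotent Latin square on `A`. -/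
structure IsIdempotentQuasigroup {A : Type*} (q : A → A → A) : Prop where
  left_injective (i : A) : Injective (q i)
  right_injective (j : A) : Injective fun i => q i j
  idem (i : A) : q i i = i

theorem ZMod.two_mul_injective_of_odd {m : ℕ} (hm : Odd m) :
    Injective fun x : ZMod m => 2 * x := by
  have h : IsUnit (2 : ZMod m) := by
    have := (ZMod.isUnit_iff_coprime 2 m).2 ((Nat.coprime_two_left).2 hm)
    exact_mod_cast this
  exact h.mul_right_injective

theorem isIdempotentQuasigroup_zmod {m : ℕ} (hm : Odd m) :
    IsIdempotentQuasigroup fun i j : ZMod m => 2 * j - i where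
  left_injective i j j' h := ZMod.two_mul_injective_of_odd hm (sub_left_inj.1 h)
  right_injective j i i' h := sub_right_inj.1 h
  idem i := by ring

open Classical in
/-- Prolongation of a Latin square along the transversal consisting of the cells `(i, τ i)`. -/
noncomputable def prolongation {A : Type*} (q : A → A → A) (τ : A ≃ A) :
    Option A → Option A → Option A
  | none, none => none
  | some i, none => some (q i (τ i))
  | none, some j => some (q (τ.symm j) j)
  | some i, some j => if j = τ i then none else some (q i j)

/-- The symbols on the transversal move to the new row and column, and the new symbol takes their
place; `hτ` keeps the old diagonal untouched. -/
theorem IsIdempotentQuasigroup.prolongation {A : Type*} {q : A → A → A}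
    (hq : IsIdempotentQuasigroup q) {τ : A ≃ A} (hτ : ∀ i, τ i ≠ i)
    (ht : Injective fun i => q i (τ i)) : IsIdempotentQuasigroup (prolongation q τ) where
  left_injective := by
    rintro (_ | i) (_ | j) (_ | j') h
    · rfl
    · simp [_root_.prolongation] at h
    · simp [_root_.prolongation] at h
    · have : q (τ.symm j) (τ (τ.symm j)) = q (τ.symm j') (τ (τ.symm j')) := by
        simpa [_root_.prolongation] using h
      rw [τ.symm.injective (ht this)]
    · rfl
    · simp only [_root_.prolongation] at h
      split_ifs at h with h₁
      exact absurd (hq.left_injective i (Option.some.inj h)).symm h₁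
    · simp only [_root_.prolongation] at h
      split_ifs at h with h₁
      exact absurd (hq.left_injective i (Option.some.inj h)) h₁
    · simp only [_root_.prolongation] at h
      split_ifs at h with h₁ h₂
      · rw [h₁, h₂]
      · rw [hq.left_injective i (Option.some.inj h)]
  right_injective := by
    rintro (_ | j) (_ | i) (_ | i') h
    · rfl
    · simp [_root_.prolongation] at h
    · simp [_root_.prolongation] at h
    · rw [ht (Option.some.inj h)]
    · rfl
    · simp only [_root_.prolongation] at h
      split_ifs at h with h₁
      refine absurd ?_ h₁
      rw [← hq.right_injective j (Option.some.inj h), τ.apply_symm_apply]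
    · simp only [_root_.prolongation] at h
      split_ifs at h with h₁
      refine absurd ?_ h₁
      rw [hq.right_injective j (Option.some.inj h), τ.apply_symm_apply]
    · simp only [_root_.prolongation] at h
      split_ifs at h with h₁ h₂
      · rw [τ.injective (h₁.symm.trans h₂)]
      · rw [hq.right_injective j (Option.some.inj h)]
  idem := by
    rintro (_ | i)
    · rfl
    · simp [_root_.prolongation, (hτ i).symm, hq.idem]

theorem exists_isIdempotentQuasigroup {m : ℕ} (hm : 3 ≤ m) :
    ∃ (A : Type) (_ : Fintype A) (q : A → A → A),
      Fintype.card A = m ∧ IsIdempotentQuasigroup q := by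
  rcases Nat.even_or_odd m with he | ho
  · obtain ⟨l, rfl⟩ : ∃ l, m = l + 1 := ⟨m - 1, by omega⟩
    have ho : Odd l := by
      rcases Nat.even_or_odd l with h | h
      · exact absurd h.add_one (Nat.not_odd_iff_even.2 he)
      · exact h
    have : NeZero l := ⟨by omega⟩
    have : Fact (1 < l) := ⟨by omega⟩
    refine ⟨Option (ZMod l), inferInstance, _, by simp [ZMod.card],
      (isIdempotentQuasigroup_zmod ho).prolongation (τ := Equiv.addRight 1) (by simp) ?_⟩
    intro i j h
    -- The cell `(i, i + 1)` holds `2(i + 1) - i = i + 2`.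
    have : i + 2 = j + 2 := by
      simp only [Equiv.coe_addRight] at h
      linear_combination h
    exact add_right_cancel this
  · have : NeZero m := ⟨by omega⟩
    exact ⟨ZMod m, inferInstance, _, ZMod.card m, isIdempotentQuasigroup_zmod ho⟩

end IdempotentQuasigroups

/-! ### Odd orders and the lower bound -/

section OddOrder

open Function

variable {A : Type*}

open Classical in
/-- A Latin square of order `2|A| + 1`, in which the rows `(i, ·)` and the columns `(j, ·)` with
`i ≠ j` intersect in a subsquare of order two. -/
noncomputable def doubledSquare (q : A → A → A) :
    Option (A × ZMod 2) → Option (A × ZMod 2) → Option (A × ZMod 2)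
  | none, none => none
  | some x, none => some x
  | none, some y => some (y.1, y.2 + 1)
  | some x, some y =>
    if x.1 = y.1 then if x.2 = y.2 then none else some y else some (q x.1 y.1, x.2 + y.2)

theorem ZMod.eq_add_one_of_ne {e d : ZMod 2} (h : e ≠ d) : e = d + 1 := by
  revert e d; decide

/-- Idempotence makes the symbols over `i` absent from the off-diagonal blocks of row pair `i`, so
the diagonal block and column `none` can use them up together with `none`. -/
theorem doubledSquare_left_injective {q : A → A → A} (hq : IsIdempotentQuasigroup q)
    (x : Option (A × ZMod 2)) : Injective (doubledSquare q x) := by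
  have hi (i j : A) (h : q i j = i) : i = j :=
    hq.left_injective i ((hq.idem i).trans h.symm)
  rcases x with _ | ⟨i, e⟩
  · rintro (_ | ⟨j, d⟩) (_ | ⟨j', d'⟩) h <;> simp_all [doubledSquare]
  · rintro (_ | ⟨j, d⟩) (_ | ⟨j', d'⟩) h
    · rfl
    · simp only [doubledSquare] at h
      split_ifs at h <;> grind
    · simp only [doubledSquare] at h
      split_ifs at h <;> grind
    · have := @hq.left_injective i j j'
      have h₁ := @ZMod.eq_add_one_of_ne e d
      have h₂ := @ZMod.eq_add_one_of_ne e d'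
      have h₃ := @add_left_cancel (ZMod 2) _ _ e d d'
      simp only [doubledSquare] at h
      split_ifs at h <;> grind

theorem doubledSquare_right_injective {q : A → A → A} (hq : IsIdempotentQuasigroup q)
    (y : Option (A × ZMod 2)) : Injective fun x => doubledSquare q x y := by
  have hi (i j : A) (h : q i j = j) : i = j :=
    hq.right_injective j (h.trans (hq.idem j).symm)
  rcases y with _ | ⟨j, d⟩
  · rintro (_ | ⟨i, e⟩) (_ | ⟨i', e'⟩) h <;> simp_all [doubledSquare]
  · have hd : d + 1 ≠ d := by simp
    rintro (_ | ⟨i, e⟩) (_ | ⟨i', e'⟩) h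
    · rfl
    · simp only [doubledSquare] at h
      split_ifs at h <;> grind
    · simp only [doubledSquare] at h
      split_ifs at h <;> grind
    · have := @hq.right_injective j i i'
      have h₁ := @ZMod.eq_add_one_of_ne e d
      have h₂ := @ZMod.eq_add_one_of_ne e' d
      have h₃ := @add_right_cancel (ZMod 2) _ _ e d e'
      simp only [doubledSquare] at h
      split_ifs at h <;> grind

theorem two_pow_le_ncard_nQuasigroups_odd {m : ℕ} (hm : 3 ≤ m) (n : ℕ) :
    2 ^ (m * (m - 1) ^ n) ≤ (nQuasigroups (n + 1) (2 * m + 1)).ncard := by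
  classical
  obtain ⟨A, _, q, hA, hq⟩ := exists_isIdempotentQuasigroup hm
  obtain ⟨f, w, V, hf, hV, hw⟩ := exists_iterated_quasigroup (ι := some)
    (doubledSquare_left_injective hq) (doubledSquare_right_injective hq)
    (q := q) (J := fun i => {i}ᶜ) (t := m - 1)
    (fun i => by rw [Finset.card_compl, hA, Finset.card_singleton])
    (fun i j hj e d => by
      have : i ≠ j := by rintro rfl; simp at hj
      simp [doubledSquare, this]) n
  rw [hA] at hV
  refine (Nat.pow_le_pow_right two_pos hV).trans ?_
  refine two_pow_card_le_ncard_nQuasigroups (ι := some) (flip := Option.map fun p => (p.1, p.2 + 1))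
    ?_ (Option.some_injective _) (Option.map_injective ?_) (fun _ _ => rfl) hf hw
  · simp [ZMod.card, hA]; ring
  · rintro ⟨a, e⟩ ⟨b, d⟩ h
    simpa using h

theorem two_pow_le_ncard_nQuasigroups {n k : ℕ} (hn : 1 ≤ n) (hk : 1 ≤ k) :
    2 ^ ((k / 2) * (k / 3) ^ (n - 1)) ≤ (nQuasigroups n k).ncard := by
  obtain ⟨n, rfl⟩ : ∃ l, n = l + 1 := ⟨n - 1, by omega⟩
  rw [Nat.add_sub_cancel]
  obtain ⟨m, rfl | rfl⟩ := Nat.even_or_odd' k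
  · have : NeZero m := ⟨by omega⟩
    have h := pow_pow_le_ncard_nQuasigroups (n + 1) m 2
    rw [mul_comm m 2] at h
    refine (Nat.pow_le_pow_right two_pos ?_).trans h
    rw [pow_succ', Nat.mul_div_cancel_left m two_pos]
    exact Nat.mul_le_mul_left _ (Nat.pow_le_pow_left (by omega) _)
  · rcases Nat.lt_or_ge m 3 with hm | hm
    -- For `k = 1, 3, 5` the `k` translates of the cyclic sum suffice: `1 ≤ 1`, `2 ≤ 3`, `4 ≤ 5`.
    · have h := pow_pow_le_ncard_nQuasigroups (n + 1) 1 (2 * m + 1)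
      rw [one_mul, one_pow, pow_one] at h
      refine le_trans ?_ h
      interval_cases m <;> simp
    · refine (Nat.pow_le_pow_right two_pos ?_).trans (two_pow_le_ncard_nQuasigroups_odd hm n)
      rw [show (2 * m + 1) / 2 = m by omega]
      exact Nat.mul_le_mul_left _ (Nat.pow_le_pow_left (by omega) _)

end OddOrder

/-! ### Numerical estimates -/

section Estimates

theorem exp_neg_lt_log_two : Real.exp (-0.367) < Real.log 2 := by
  have h := Real.sum_le_exp_of_nonneg (x := 0.367) (by norm_num) 5
  norm_num [Finset.sum_range_succ, Nat.factorial] at h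
  have h2 := Real.log_two_gt_d9
  rw [Real.exp_neg, inv_lt_comm₀ (Real.exp_pos _) (by linarith)]
  refine lt_of_lt_of_le ?_ (by norm_num; exact h)
  rw [inv_lt_comm₀ (by linarith) (by norm_num)]
  refine lt_trans ?_ h2
  norm_num

/-- Here `0.405 = 0.367 + 0.038`, and `1075 / 717` is `⌊k/2⌋ / ⌊k/3⌋` at `k = 2151`. -/
theorem exp_lt_ratio : Real.exp 0.405 < 1075 / 717 := by
  have h := Real.exp_bound' (x := 0.405) (by norm_num) (by norm_num) (n := 9) (by norm_num)
  norm_num [Finset.sum_range_succ, Nat.factorial] at h ⊢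
  linarith

theorem exp_lt_log_three : Real.exp 0.038 < Real.log 3 := by
  have h := Real.exp_bound' (x := 0.038) (by norm_num) (by norm_num) (n := 3) (by norm_num)
  norm_num [Finset.sum_range_succ, Nat.factorial] at h
  have h3 : (1.08 : ℝ) < Real.log 3 := by
    have h2 := Real.log_two_gt_d9
    -- `2^19 < 3^12` transfers the bound on `log 2` to `log 3`.
    have := Real.log_le_log (x := 2 ^ 19) (y := 3 ^ 12) (by norm_num) (by norm_num)
    rw [Real.log_pow, Real.log_pow] at this
    push_cast at this
    linarith
  norm_num at h3 ⊢
  linarith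

theorem exp_exp_lt_two_pow {a b : ℕ} (ha : 0 < a) (hb : 0 < b) (n : ℕ) :
    Real.exp (Real.exp (Real.log a * (n + 1 : ℕ) + Real.log b - Real.log a - 0.367)) <
      (2 : ℝ) ^ (b * a ^ n) := by
  have ha' : (0 : ℝ) < a := Nat.cast_pos.2 ha
  have hb' : (0 : ℝ) < b := Nat.cast_pos.2 hb
  have h : Real.exp (Real.log a * (n + 1 : ℕ) + Real.log b - Real.log a - 0.367) =
      b * a ^ n * Real.exp (-0.367) := by
    rw [show Real.log a * (n + 1 : ℕ) + Real.log b - Real.log a - 0.367 =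
      Real.log b + n * Real.log a + -0.367 by push_cast; ring, Real.exp_add, Real.exp_add,
      Real.exp_log hb', Real.exp_nat_mul, Real.exp_log ha']
  rw [h, ← Real.exp_log (show (0 : ℝ) < 2 ^ (b * a ^ n) by positivity), Real.log_pow]
  push_cast
  gcongr
  exact exp_neg_lt_log_two

theorem exp_ratio_lt_div {k : ℕ} (hk : 3 ≤ k) (h : k % 6 ≠ 3 ∨ 2151 ≤ k) :
    Real.exp 0.405 < ((k / 2 : ℕ) : ℝ) / ((k / 3 : ℕ) : ℝ) := by
  -- The ratio is at least `3/2` unless `k = 6s + 3`, when it is `(3s+1)/(2s+1)`, increasing in `s`.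
  have h₁ : 1075 * (k / 3) ≤ 717 * (k / 2) := by omega
  have h₂ : (1075 * (k / 3 : ℕ) : ℝ) ≤ 717 * (k / 2 : ℕ) := by exact_mod_cast h₁
  have h₃ : (0 : ℝ) < (k / 3 : ℕ) := Nat.cast_pos.2 (by omega)
  refine exp_lt_ratio.trans_le ?_
  rw [div_le_div_iff₀ (by norm_num) h₃]
  linarith

theorem exp_exp_lt_exp_exp {k : ℕ} (hk : 3 ≤ k) (h : k % 6 ≠ 3 ∨ 2151 ≤ k) (x : ℝ) :
    Real.exp (Real.exp (x + 0.038)) < Real.exp (Real.exp (x + Real.log ((k / 2 : ℕ) : ℝ) -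
      Real.log ((k / 3 : ℕ) : ℝ) - 0.367)) := by
  have ha : (0 : ℝ) < (k / 3 : ℕ) := Nat.cast_pos.2 (by omega)
  have hb : (0 : ℝ) < (k / 2 : ℕ) := Nat.cast_pos.2 (by omega)
  have h₁ := Real.log_lt_log (Real.exp_pos _) (exp_ratio_lt_div hk h)
  rw [Real.log_exp, Real.log_div hb.ne' ha.ne'] at h₁
  rw [Real.exp_lt_exp, Real.exp_lt_exp]
  linarith

theorem exp_exp_lt_ncard_nQuasigroups_of_three_dvd {k : ℕ} (hk : 3 ≤ k) (h : 3 ∣ k) (n : ℕ) :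
    Real.exp (Real.exp (Real.log ((k / 3 : ℕ) : ℝ) * n + 0.038)) <
      ((nQuasigroups n k).ncard : ℝ) := by
  obtain ⟨t, rfl⟩ := h
  have : NeZero t := ⟨by omega⟩
  have ht : (0 : ℝ) < t := Nat.cast_pos.2 (NeZero.pos t)
  have h₁ : ((3 ^ t ^ n : ℕ) : ℝ) ≤ _ := Nat.cast_le.2 (pow_pow_le_ncard_nQuasigroups n t 3)
  rw [mul_comm t 3] at h₁
  refine lt_of_lt_of_le ?_ h₁
  rw [Nat.mul_div_cancel_left t (by norm_num), mul_comm, Real.exp_add, Real.exp_nat_mul,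
    Real.exp_log ht]
  push_cast
  rw [← Real.exp_log (show (0 : ℝ) < 3 ^ t ^ n by positivity), Real.log_pow]
  push_cast
  gcongr
  exact exp_lt_log_three

end Estimates

theorem mainTheorem4 (n k : ℕ) (hn : 1 ≤ n) (hk : 1 ≤ k) :
    2 ^ ((k / 2) * (k / 3) ^ (n - 1)) ≤ (nQuasigroups n k).ncard ∧
    (3 ≤ k →
      Real.exp (Real.exp (Real.log ((k / 3 : ℕ) : ℝ) * n + Real.log ((k / 2 : ℕ) : ℝ)
          - Real.log ((k / 3 : ℕ) : ℝ) - 0.367))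
        < (2 : ℝ) ^ ((k / 2) * (k / 3) ^ (n - 1)) ∧
      (k % 6 ≠ 3 ∨ 2151 ≤ k →
        Real.exp (Real.exp (Real.log ((k / 3 : ℕ) : ℝ) * n + 0.038))
          < Real.exp (Real.exp (Real.log ((k / 3 : ℕ) : ℝ) * n + Real.log ((k / 2 : ℕ) : ℝ)
              - Real.log ((k / 3 : ℕ) : ℝ) - 0.367))) ∧
      Real.exp (Real.exp (Real.log ((k / 3 : ℕ) : ℝ) * n + 0.038))
        < ((nQuasigroups n k).ncard : ℝ)) := by
  have hQ := two_pow_le_ncard_nQuasigroups hn hk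
  refine ⟨hQ, fun hk3 => ?_⟩
  have h₁ : Real.exp (Real.exp (Real.log ((k / 3 : ℕ) : ℝ) * n + Real.log ((k / 2 : ℕ) : ℝ)
      - Real.log ((k / 3 : ℕ) : ℝ) - 0.367)) < (2 : ℝ) ^ ((k / 2) * (k / 3) ^ (n - 1)) := by
    have h := exp_exp_lt_two_pow (a := k / 3) (b := k / 2) (by omega) (by omega) (n - 1)
    rwa [Nat.sub_add_cancel hn] at h
  refine ⟨h₁, fun h => exp_exp_lt_exp_exp hk3 h _, ?_⟩
  -- In this class the binary bound can be too weak; the base 3 from `3 ∣ k` replaces it.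
  by_cases h : k % 6 = 3
  · exact exp_exp_lt_ncard_nQuasigroups_of_three_dvd hk3 (by omega) n
  · exact ((exp_exp_lt_exp_exp hk3 (Or.inl h) _).trans h₁).trans_le (by exact_mod_cast hQ)
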